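/- Let $K$ be an infinite field and let $m,n\ge 0$ be integers. Let $V$ be a $2m$-dimensional $K$-vector space with a non-degenerate alternating form $(\ ,\ )$. Put $i'=2m+1-i$ for $1\le i\le 2m$, and fix a basis $v_1,\dots,v_{2m}$ of $V$ with $(v_i,v_j)=\epsilon_{i,j}$, where $\epsilon_{i,i'}=1$ if $i<i'$, $\epsilon_{i,i'}=-1$ if $i>i'$, and $\epsilon_{i,j}=0$ if $j\ne i'$. (Every basis of $V$ is of this kind for exactly one form.) A Brauer $n$-diagram is a graph on a top row and a bottom row of $n$ vertices each, in which every vertex lies on exactly one edge. The Brauer algebra $\mathfrak B_n(-2m)_K$ is the unital associative $K$-algebra with generators $s_1,\dots,s_{n-1},e_1,\dots,e_{n-1}$ and relations, with $x=-2m$, $$s_i^2=1,\quad e_i^2=xe_i,\quad e_is_i=e_i=s_ie_i,$$ $$s_is_j=s_js_i,\quad s_ie_j=e_js_i,\quad e_ie_j=e_je_i\qquad(|i-j|\ge 2),$$ $$s_is_{i+1}s_i=s_{i+1}s_is_{i+1},\quad e_ie_{i+1}e_i=e_i,\quad e_{i+1}e_ie_{i+1}=e_{i+1},$$ $$s_ie_{i+1}e_i=s_{i+1}e_i,\quad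 e_{i+1}e_is_{i+1}=e_{i+1}s_i .$$ Brauer diagrams are regarded as elements of it as usual. The generator $s_i$ is the diagram of the transposition of $i$ and $i+1$. The generator $e_i$ is the diagram with horizontal edges joining $i$ and $i+1$ in both rows and vertical edges elsewhere. A product of generators whose concatenation, with the left factor on top, creates no closed loop is the resulting diagram; every diagram arises in this way. Let $\varphi:(\mathfrak B_n(-2m)_K)^{op}\to\operatorname{End}_K(V^{\otimes n})$ be the $K$-algebra homomorphism given by the right action of $\mathfrak B_n(-2m)_K$ on $V^{\otimes n}$ in which - $(v_{i_1}\otimes\cdots\otimes v_{i_n})s_j$ is minus the tensor obtained by interchanging the $j$-th and $(j+1)$-st factors; - $(v_{i_1}\otimes\cdots\otimes v_{i_n})e_j$ is $\epsilon_{i_j,i_{j+1}}$ times the tensor obtained by replacing these two factors by $\sum_{k=1}^m(v_{k'}\otimes v_k-v_k\otimes v_{k'})$. Let $0\le a,b\le n$ be integers with $a+b$ even. Let $\mathrm{BD}_n(a,b)$ be the set of all Brauer $n$-diagrams such that - the first $a$ top vertices and the first $b$ bottom vertices are joined among themselves; - for each $s$ with $\max(a,b)<s\le n$, the $s$-th top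 vertex is joined to the $s$-th bottom vertex; - if $a\ge b$, the bottom vertices $b+2s-1$ and $b+2s$ are joined for $1\le s\le (a-b)/2$; - if $b\ge a$, the top vertices $a+2s-1$ and $a+2s$ are joined for $1\le s\le (b-a)/2$. If $a+b\ge 2m+2$, then $$\sum_{D\in \mathrm{BD}_n(a,b)}D\in\operatorname{Ker}\varphi .$$ -/

import Mathlib

open scoped TensorProduct

/-! ### Brauer diagrams -/

/-- A Brauer `n`-diagram: a graph on two rows of `n` vertices in which every vertex lies on exactly
one edge, encoded by the fixed-point-free involution that sends each vertex to the other end of its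
edge. `Sum.inl i` is the `i`-th vertex of the top row, `Sum.inr i` the `i`-th vertex of the bottom
row (counted from `0`, from left to right). -/
abbrev BrauerDiagram (n : ℕ) : Type :=
  {f : Fin n ⊕ Fin n → Fin n ⊕ Fin n // (∀ x, f (f x) = x) ∧ ∀ x, f x ≠ x}

namespace BrauerDiagram

/-- The set `BD_n(a,b)` of diagrams such that
* the first `a` top and the first `b` bottom vertices are joined among themselves;
* beyond position `max a b` all edges are vertical;
* if `a > b`, the bottom vertices `b+1, …, a` (counted from `1`) are joined in consecutive pairs;
* if `b > a`, the top vertices `a+1, …, b` (counted from `1`) are joined in consecutive pairs.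

Note that `(a - b) / 2` is `0` for `a ≤ b`, and likewise `(b - a) / 2` for `b ≤ a`. -/
def IsBD {n : ℕ} (a b : ℕ) (D : BrauerDiagram n) : Prop :=
  (∀ x, Sum.elim (fun i : Fin n => (i : ℕ) < a) (fun i : Fin n => (i : ℕ) < b) x →
    Sum.elim (fun i : Fin n => (i : ℕ) < a) (fun i : Fin n => (i : ℕ) < b) (D.1 x)) ∧
  (∀ i : Fin n, max a b ≤ (i : ℕ) → D.1 (Sum.inl i) = Sum.inr i) ∧
  (∀ t < (a - b) / 2, ∀ p q : Fin n, (p : ℕ) = b + 2 * t → (q : ℕ) = b + 2 * t + 1 →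
    D.1 (Sum.inr p) = Sum.inr q) ∧
  (∀ t < (b - a) / 2, ∀ p q : Fin n, (p : ℕ) = a + 2 * t → (q : ℕ) = a + 2 * t + 1 →
    D.1 (Sum.inl p) = Sum.inl q)

open scoped Classical in
/-- `BD_n(a,b)` as a finite set. -/
noncomputable def BD (n a b : ℕ) : Finset (BrauerDiagram n) :=
  Finset.univ.filter (IsBD a b)

/-- The diagram all of whose edges are vertical. -/
def one (n : ℕ) : BrauerDiagram n :=
  ⟨Sum.swap, by simp, by rintro (i | i) <;> simp⟩

/-- Stack `D` on top of the diagram of the transposition of `p` and `q`: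
the bottom vertices `p` and `q` of `D` trade places. -/
def mulS {n : ℕ} (D : BrauerDiagram n) (p q : Fin n) : BrauerDiagram n :=
  ⟨fun x => Equiv.swap (Sum.inr p) (Sum.inr q) (D.1 (Equiv.swap (Sum.inr p) (Sum.inr q) x)),
    by intro x; simp [D.2.1], by
      intro x h
      rw [Equiv.swap_apply_eq_iff] at h
      exact D.2.2 _ h⟩

theorem rejoin_aux {α : Type*} [DecidableEq α] (f : α → α) (h1 : ∀ x, f (f x) = x)
    (h2 : ∀ x, f x ≠ x) (P Q : α) (h3 : P ≠ Q) (F : α → α) (hF : ∀ x, F x =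
    if x = P then Q else if x = Q then P else if x = f P then f Q else if x = f Q then f P
    else f x) : (∀ x, F (F x) = x) ∧ ∀ x, F x ≠ x := by
  have h4 : ∀ x y, f x = f y → x = y := fun x y e => by rw [← h1 x, ← h1 y, e]
  constructor
  · intro x
    have := h1 x
    have := h2 x
    have := h1 P
    have := h1 Q
    have := h2 P
    have := h2 Q
    rw [hF (F x), hF x]
    by_cases a1 : x = P
    · grind
    by_cases a2 : x = Q
    · grind
    by_cases a3 : x = f P
    · by_cases f Q = P <;> grind
    by_cases a4 : x = f Q
    · by_cases f P = Q <;> grind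
    have b1 : f x ≠ P := by grind
    have b2 : f x ≠ Q := by grind
    have b3 : f x ≠ f P := fun h => a1 (h4 _ _ h)
    have b4 : f x ≠ f Q := fun h => a2 (h4 _ _ h)
    simp [*]
  · intro x
    have := h2 x
    have := h2 P
    have := h2 Q
    have := h4 P Q
    rw [hF x]
    split_ifs <;> grind

/-- Stack `D` on top of the diagram with the horizontal edges `p — q` in both rows and vertical
edges elsewhere, and delete a loop if there is one: the partners in `D` of the bottom vertices `p`
and `q` are joined with each other, and `p` and `q` are joined with each other. -/
def mulE {n : ℕ} (D : BrauerDiagram n) (p q : Fin n) (h : p ≠ q) : BrauerDiagram n :=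
  ⟨fun x =>
    if x = Sum.inr p then Sum.inr q
    else if x = Sum.inr q then Sum.inr p
    else if x = D.1 (Sum.inr p) then D.1 (Sum.inr q)
    else if x = D.1 (Sum.inr q) then D.1 (Sum.inr p)
    else D.1 x,
    rejoin_aux D.1 D.2.1 D.2.2 _ _ (fun e => h (Sum.inr_injective e)) _ fun _ => rfl⟩

end BrauerDiagram

/-! ### The Brauer algebra -/

/-- The left one of the two adjacent positions belonging to the index `j`. -/
def lo {n : ℕ} (j : Fin (n - 1)) : Fin n := ⟨j, by omega⟩

/-- The right one of the two adjacent positions belonging to the index `j`. -/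
def hi {n : ℕ} (j : Fin (n - 1)) : Fin n := ⟨j + 1, by omega⟩

theorem lo_ne_hi {n : ℕ} (j : Fin (n - 1)) : lo j ≠ hi j := by
  simp [lo, hi, Fin.ext_iff]

/-- The generators `s_1, …, s_{n-1}, e_1, …, e_{n-1}` of the Brauer algebra. -/
inductive BrauerGen (n : ℕ) : Type
  | s (j : Fin (n - 1)) : BrauerGen n
  | e (j : Fin (n - 1)) : BrauerGen n

section Algebra

variable (K : Type*) [CommRing K] (n : ℕ)

/-- `s_j` in the free algebra. -/
abbrev freeS {n : ℕ} (j : Fin (n - 1)) : FreeAlgebra K (BrauerGen n) := FreeAlgebra.ι K (.s j)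

/-- `e_j` in the free algebra. -/
abbrev freeE {n : ℕ} (j : Fin (n - 1)) : FreeAlgebra K (BrauerGen n) := FreeAlgebra.ι K (.e j)

/-- The defining relations of the Brauer algebra with parameter `δ`. -/
inductive BrauerRel (δ : K) : FreeAlgebra K (BrauerGen n) → FreeAlgebra K (BrauerGen n) → Prop
  | s_sq (j) : BrauerRel δ (freeS K j * freeS K j) 1
  | e_sq (j) : BrauerRel δ (freeE K j * freeE K j) (δ • freeE K j)
  | e_s (j) : BrauerRel δ (freeE K j * freeS K j) (freeE K j)
  | s_e (j) : BrauerRel δ (freeS K j * freeE K j) (freeE K j)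
  | s_s_comm (i j : Fin (n - 1)) (h : (i : ℕ) + 1 < j) :
      BrauerRel δ (freeS K i * freeS K j) (freeS K j * freeS K i)
  | s_e_comm (i j : Fin (n - 1)) (h : (i : ℕ) + 1 < j ∨ (j : ℕ) + 1 < i) :
      BrauerRel δ (freeS K i * freeE K j) (freeE K j * freeS K i)
  | e_e_comm (i j : Fin (n - 1)) (h : (i : ℕ) + 1 < j) :
      BrauerRel δ (freeE K i * freeE K j) (freeE K j * freeE K i)
  | braid (i j : Fin (n - 1)) (h : (j : ℕ) = i + 1) :
      BrauerRel δ (freeS K i * freeS K j * freeS K i) (freeS K j * freeS K i * freeS K j)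
  | e_e_e (i j : Fin (n - 1)) (h : (j : ℕ) = i + 1) :
      BrauerRel δ (freeE K i * freeE K j * freeE K i) (freeE K i)
  | e_e_e' (i j : Fin (n - 1)) (h : (j : ℕ) = i + 1) :
      BrauerRel δ (freeE K j * freeE K i * freeE K j) (freeE K j)
  | s_e_e (i j : Fin (n - 1)) (h : (j : ℕ) = i + 1) :
      BrauerRel δ (freeS K i * freeE K j * freeE K i) (freeS K j * freeE K i)
  | e_e_s (i j : Fin (n - 1)) (h : (j : ℕ) = i + 1) :
      BrauerRel δ (freeE K j * freeE K i * freeS K j) (freeE K j * freeS K i)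

/-- The Brauer algebra over `K` with parameter `δ`, by generators and relations. -/
abbrev BrauerAlgebra (δ : K) : Type _ := RingQuot (BrauerRel K n δ)

namespace BrauerAlgebra

variable {K n} {δ : K}

/-- The generator `s_j`. -/
noncomputable def s (j : Fin (n - 1)) : BrauerAlgebra K n δ :=
  RingQuot.mkAlgHom K (BrauerRel K n δ) (freeS K j)

/-- The generator `e_j`. -/
noncomputable def e (j : Fin (n - 1)) : BrauerAlgebra K n δ :=
  RingQuot.mkAlgHom K (BrauerRel K n δ) (freeE K j)

/-- `Represents D y`: the element `y` of the Brauer algebra is the Brauer diagram `D`.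
The unit is the diagram with vertical edges only. If `y` is `D`, then `y * s_j` and `y * e_j` are
the diagrams obtained by stacking `D` on top of the diagram of the generator, provided that no loop
arises. Every diagram is obtained in this way, see `exists_represents`. (That the element depends
only on the diagram is the agreement of the presentation with the diagram algebra; nothing below
relies on it.) -/
inductive Represents : BrauerDiagram n → BrauerAlgebra K n δ → Prop
  | one : Represents (BrauerDiagram.one n) 1
  | mul_s {D : BrauerDiagram n} {y : BrauerAlgebra K n δ} (h : Represents D y)
      (j : Fin (n - 1)) : Represents (D.mulS (lo j) (hi j)) (y * s j)
  | mul_e {D : BrauerDiagram n} {y : BrauerAlgebra K n δ} (h : Represents D y)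
      (j : Fin (n - 1)) (hj : D.1 (Sum.inr (lo j)) ≠ Sum.inr (hi j)) :
      Represents (D.mulE (lo j) (hi j) (lo_ne_hi j)) (y * e j)

/-- Relabel the bottom vertices of a diagram. -/
def relabel (D : BrauerDiagram n) (σ : Equiv.Perm (Fin n)) : BrauerDiagram n :=
  ⟨fun x => Sum.map id σ (D.1 (Sum.map id σ.symm x)), by
      intro x
      have : ∀ z : Fin n ⊕ Fin n, Sum.map id σ.symm (Sum.map id σ z) = z := by
        rintro (z | z) <;> simp
      dsimp only
      rw [this, D.2.1]
      rcases x with x | x <;> simp, by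
      intro x h
      have : ∀ z : Fin n ⊕ Fin n, Sum.map id σ.symm (Sum.map id σ z) = z := by
        rintro (z | z) <;> simp
      have h' := congrArg (Sum.map id σ.symm) h
      rw [this] at h'
      exact D.2.2 _ h'⟩

theorem exists_relabel (σ : Equiv.Perm (Fin n)) : ∀ D : BrauerDiagram n,
    (∃ y : BrauerAlgebra K n δ, Represents D y) →
    ∃ y : BrauerAlgebra K n δ, Represents (relabel D σ) y := by
  obtain _ | N := n
  · intro D hD
    rwa [Subsingleton.elim (relabel D σ) D]
  have hσ : σ ∈ Submonoid.closure
      (Set.range fun i : Fin N => Equiv.swap i.castSucc i.succ) := by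
    rw [Equiv.Perm.mclosure_swap_castSucc_succ]; trivial
  induction hσ using Submonoid.closure_induction with
  | mem x hx =>
    obtain ⟨j, rfl⟩ := hx
    rintro D ⟨y, hy⟩
    let j' : Fin (N + 1 - 1) := j
    refine ⟨y * s j', ?_⟩
    have hy' := hy.mul_s j'
    have h : ∀ z : Fin (N + 1) ⊕ Fin (N + 1),
        Sum.map id (Equiv.swap j.castSucc j.succ) z =
          Equiv.swap (Sum.inr j.castSucc) (Sum.inr j.succ) z := by
      rintro (z | z)
      · rw [Equiv.swap_apply_of_ne_of_ne] <;> simp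
      · simp only [Sum.map_inr, Equiv.swap_apply_def, Sum.inr.injEq]
        split_ifs <;> rfl
    have he : relabel D (Equiv.swap j.castSucc j.succ) = D.mulS (lo j') (hi j') := by
      refine Subtype.ext (funext fun x => ?_)
      simp only [relabel, Equiv.symm_swap, h]
      rfl
    rwa [← he] at hy'
  | one =>
    intro D hD
    have he : relabel D 1 = D := by
      refine Subtype.ext (funext fun x => ?_)
      change Sum.map id id (D.1 (Sum.map id id x)) = _
      simp
    rwa [he]
  | mul σ τ _ _ h1 h2 =>
    intro D hD
    have he : relabel D (σ * τ) = relabel (relabel D τ) σ := by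
      refine Subtype.ext (funext fun x => ?_)
      change Sum.map id (σ ∘ τ) (D.1 (Sum.map id (τ.symm ∘ σ.symm) x)) = _
      simp [relabel]
    rw [he]
    exact h1 _ (h2 _ hD)

theorem relabel_mulE (D : BrauerDiagram n) (σ : Equiv.Perm (Fin n)) (p q : Fin n) (h : p ≠ q) :
    relabel (D.mulE p q h) σ = (relabel D σ).mulE (σ p) (σ q) (σ.injective.ne h) := by
  refine Subtype.ext (funext fun x => ?_)
  have key : ∀ z w : Fin n ⊕ Fin n, Sum.map id σ.symm z = w ↔ z = Sum.map id σ w := by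
    rintro (z | z) (w | w) <;> simp [Equiv.symm_apply_eq]
  simp only [relabel, BrauerDiagram.mulE, key, Sum.map_inr, Equiv.symm_apply_apply]
  split_ifs <;> rfl

theorem exists_mulE (D : BrauerDiagram n) (p q : Fin n) (h : p ≠ q)
    (hD : D.1 (Sum.inr p) ≠ Sum.inr q) (hR : ∃ y : BrauerAlgebra K n δ, Represents D y) :
    ∃ y : BrauerAlgebra K n δ, Represents (D.mulE p q h) y := by
  have hn : 0 < n - 1 := by
    have := p.2
    have := q.2
    have : (p : ℕ) ≠ q := fun e => h (Fin.ext e)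
    omega
  obtain ⟨σ, hp, hq⟩ : ∃ σ : Equiv.Perm (Fin n), σ p = lo ⟨0, hn⟩ ∧ σ q = hi ⟨0, hn⟩ := by
    have ha := lo_ne_hi (⟨0, hn⟩ : Fin (n - 1))
    generalize lo (⟨0, hn⟩ : Fin (n - 1)) = a at *
    generalize hi (⟨0, hn⟩ : Fin (n - 1)) = b at *
    refine ⟨Equiv.swap (Equiv.swap p a q) b * Equiv.swap p a, ?_, ?_⟩
    · simp only [Equiv.Perm.mul_apply, Equiv.swap_apply_left]
      refine Equiv.swap_apply_of_ne_of_ne (fun e => h ?_) ha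
      rw [eq_comm, Equiv.swap_apply_eq_iff, Equiv.swap_apply_right] at e
      exact e.symm
    · simp
  obtain ⟨y, hy⟩ := exists_relabel σ D hR
  have h1 := exists_relabel σ.symm _ ⟨_, hy.mul_e ⟨0, hn⟩ (by
    rw [← hp, ← hq]
    simp only [relabel, Sum.map_inr, Equiv.symm_apply_apply]
    intro e
    apply hD
    have := congrArg (Sum.map id σ.symm) e
    rcases hz : D.1 (Sum.inr p) with z | z
    · simp [hz] at e
    · rw [hz] at e
      simpa using e)⟩
  have he : relabel ((relabel D σ).mulE (lo ⟨0, hn⟩) (hi ⟨0, hn⟩) (lo_ne_hi _)) σ.symm =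
      D.mulE p q h := by
    have : (relabel D σ).mulE (lo ⟨0, hn⟩) (hi ⟨0, hn⟩) (lo_ne_hi _) =
        relabel (D.mulE p q h) σ := by
      simp only [relabel_mulE, hp, hq]
    rw [this]
    refine Subtype.ext (funext fun x => ?_)
    simp [relabel]
  rwa [he] at h1

/-- Every Brauer diagram is an element of the Brauer algebra. -/
theorem exists_represents (D : BrauerDiagram n) :
    ∃ y : BrauerAlgebra K n δ, Represents D y := by
  induction hc : (Finset.univ.filter fun x : Fin n => (D.1 (Sum.inr x)).isRight).card
    using Nat.strong_induction_on generalizing D with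
  | _ c ih =>
  by_cases hb : ∃ p q, D.1 (Sum.inr p) = Sum.inr q
  · obtain ⟨p, q, hpq⟩ := hb
    obtain ⟨u, w, huw⟩ : ∃ u w, D.1 (Sum.inl u) = Sum.inl w := by
      by_contra! hno
      have : ∀ u, ∃ x, D.1 (Sum.inl u) = Sum.inr x := by
        intro u
        rcases hz : D.1 (Sum.inl u) with z | z
        · exact absurd hz (hno u z)
        · exact ⟨z, rfl⟩
      choose g hg using this
      have hinj : Function.Injective g := by
        intro u u' e
        have := D.2.1 (Sum.inl u)
        rw [hg, e, ← hg, D.2.1] at this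
        exact (Sum.inl_injective this).symm
      obtain ⟨u, rfl⟩ := (Finite.injective_iff_surjective.1 hinj) p
      rw [← hg, D.2.1] at hpq
      cases hpq
    have hpq' : p ≠ q := by
      rintro rfl
      exact D.2.2 _ hpq
    have huw' : u ≠ w := by
      rintro rfl
      exact D.2.2 _ huw
    have hqp : D.1 (Sum.inr q) = Sum.inr p := by rw [← hpq, D.2.1]
    have hwu : D.1 (Sum.inl w) = Sum.inl u := by rw [← huw, D.2.1]
    have hinj : ∀ x y, D.1 x = y → x = D.1 y := fun x y e => by rw [← e, D.2.1]
    let F : Fin n ⊕ Fin n → Fin n ⊕ Fin n := fun x =>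
      if x = Sum.inr p then Sum.inl u else if x = Sum.inl u then Sum.inr p
      else if x = Sum.inr q then Sum.inl w else if x = Sum.inl w then Sum.inr q else D.1 x
    have hF : (∀ x, F (F x) = x) ∧ ∀ x, F x ≠ x := by
      constructor
      · intro x
        by_cases h1 : x = Sum.inr p
        · simp [F, h1]
        by_cases h2 : x = Sum.inl u
        · simp [F, h2]
        by_cases h3 : x = Sum.inr q
        · simp [F, h3, hpq'.symm, huw'.symm]
        by_cases h4 : x = Sum.inl w
        · simp [F, h4, hpq'.symm, huw'.symm]
        have k1 : D.1 x ≠ Sum.inr p := fun e => h3 ((hinj _ _ e).trans hpq)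
        have k2 : D.1 x ≠ Sum.inl u := fun e => h4 ((hinj _ _ e).trans huw)
        have k3 : D.1 x ≠ Sum.inr q := fun e => h1 ((hinj _ _ e).trans hqp)
        have k4 : D.1 x ≠ Sum.inl w := fun e => h2 ((hinj _ _ e).trans hwu)
        simp [F, h1, h2, h3, h4, k1, k2, k3, k4, D.2.1]
      · intro x
        simp only [F]
        by_cases h1 : x = Sum.inr p
        · simp [h1]
        by_cases h2 : x = Sum.inl u
        · simp [h2]
        by_cases h3 : x = Sum.inr q
        · simp [h3, hpq'.symm]
        by_cases h4 : x = Sum.inl w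
        · simp [h4, huw'.symm]
        simpa [h1, h2, h3, h4] using D.2.2 x
    have hR := ih _ (by
      rw [← hc]
      apply Finset.card_lt_card
      rw [Finset.ssubset_iff_of_subset]
      · exact ⟨p, by simp [hpq], by simp [F]⟩
      · intro x
        simp only [Finset.mem_filter, Finset.mem_univ, true_and, F]
        split_ifs with k1 k2 k3
        · simp
        · cases k2
        · simp
        · exact id) ⟨F, hF⟩ rfl
    have he : BrauerDiagram.mulE ⟨F, hF⟩ p q hpq' = D := by
      refine Subtype.ext (funext fun x => ?_)
      simp only [BrauerDiagram.mulE]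
      have e1 : F (Sum.inr p) = Sum.inl u := by simp [F]
      have e2 : F (Sum.inr q) = Sum.inl w := by simp [F, hpq'.symm]
      rw [e1, e2]
      split_ifs with h1 h2 h3 h4
      · rw [h1, hpq]
      · rw [h2, hqp]
      · rw [h3, huw]
      · rw [h4, hwu]
      · simp [F, h1, h2, h3, h4]
    rw [← he]
    exact exists_mulE ⟨F, hF⟩ p q hpq' (by simp [F]) hR
  · push Not at hb
    have : ∀ x, ∃ u, D.1 (Sum.inr x) = Sum.inl u := by
      intro x
      rcases hz : D.1 (Sum.inr x) with z | z
      · exact ⟨z, rfl⟩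
      · exact absurd hz (hb x z)
    choose g hg using this
    have hinj : Function.Injective g := by
      intro u u' e
      have := D.2.1 (Sum.inr u)
      rw [hg, e, ← hg, D.2.1] at this
      exact (Sum.inr_injective this).symm
    let τ : Equiv.Perm (Fin n) := Equiv.ofBijective g (Finite.injective_iff_bijective.1 hinj)
    have hg' : ∀ u, D.1 (Sum.inl u) = Sum.inr (τ.symm u) := by
      intro u
      conv_lhs => rw [← τ.apply_symm_apply u]
      change D.1 (Sum.inl (g _)) = _
      rw [← hg, D.2.1]
    have he : relabel (BrauerDiagram.one n) τ.symm = D := by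
      refine Subtype.ext (funext fun x => ?_)
      rcases x with x | x
      · simp [relabel, BrauerDiagram.one, hg']
      · simp [relabel, BrauerDiagram.one, hg, τ]
    rw [← he]
    exact exists_relabel τ.symm (BrauerDiagram.one n) ⟨1, Represents.one⟩

end BrauerAlgebra

end Algebra

/-! ### The action on tensor space -/

section Action

variable {K : Type*} [CommRing K] {m : ℕ}

/-- The Gram matrix `ε` of the symplectic form `(v_i, v_{i'}) = 1` for `i < i'`, where
`i' = 2m + 1 - i` in the counting from `1`. -/
def symplEps (K : Type*) [CommRing K] {m : ℕ} (i j : Fin (2 * m)) : K :=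
  if j = i.rev then (if i < j then 1 else -1) else 0

variable {V : Type*} [AddCommGroup V] [Module K V] (v : Module.Basis (Fin (2 * m)) K V) (n : ℕ)

/-- The basis `v_{i_1} ⊗ ⋯ ⊗ v_{i_n}` of the tensor space. -/
noncomputable def tensorBasis :
    Module.Basis (Fin n → Fin (2 * m)) K (⨂[K] _ : Fin n, V) :=
  Basis.piTensorProduct fun _ => v

theorem tensorBasis_apply (i : Fin n → Fin (2 * m)) :
    tensorBasis v n i = ⨂ₜ[K] r, v (i r) := by
  simp [tensorBasis]

variable {n}

/-- The tuple `i` with entries at the positions `p` and `q` replaced by `x` and `y`. -/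
def put {α : Type*} (p q : Fin n) (i : Fin n → α) (x y : α) : Fin n → α :=
  fun r => if r = p then x else if r = q then y else i r

/-- Minus the interchange of the tensor factors at the positions `p` and `q`. -/
noncomputable def actS (p q : Fin n) : Module.End K (⨂[K] _ : Fin n, V) :=
  (tensorBasis v n).constr K fun i => - tensorBasis v n (put p q i (i q) (i p))

/-- Contraction of the tensor factors at the positions `p` and `q` against the form, followed by
insertion of `∑ k, (v_{k'} ⊗ v_k - v_k ⊗ v_{k'})`, `1 ≤ k ≤ m`, at these positions. -/
noncomputable def actE (p q : Fin n) : Module.End K (⨂[K] _ : Fin n, V) :=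
  (tensorBasis v n).constr K fun i => symplEps K (i p) (i q) •
    ∑ k : Fin m,
      (tensorBasis v n (put p q i (k.castLE (by omega)).rev (k.castLE (by omega))) -
       tensorBasis v n (put p q i (k.castLE (by omega)) (k.castLE (by omega)).rev))

/-- The right action of the generators on the tensor space. -/
noncomputable def actGen : BrauerGen n → Module.End K (⨂[K] _ : Fin n, V)
  | .s j => actS v (lo j) (hi j)
  | .e j => actE v (lo j) (hi j)

theorem actS_apply (p q : Fin n) (i : Fin n → Fin (2 * m)) :
    actS v p q (tensorBasis v n i) = - tensorBasis v n (put p q i (i q) (i p)) := by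
  simp [actS]

/-- The sign of `(v_i, v_{i'})`. -/
def sg (K : Type*) [CommRing K] {m : ℕ} (i : Fin (2 * m)) : K := if i < i.rev then 1 else -1

theorem sg_rev (i : Fin (2 * m)) : sg K i.rev = - sg K i := by
  unfold sg
  rw [Fin.rev_rev]
  have : i ≠ i.rev := by
    intro h
    have := congrArg Fin.val h
    rw [Fin.val_rev] at this
    omega
  rcases lt_or_gt_of_ne this with h | h
  · simp [h, not_lt.2 h.le]
  · simp [h, not_lt.2 h.le]

theorem sg_mul_self (i : Fin (2 * m)) : sg K i * sg K i = 1 := by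
  unfold sg
  split_ifs <;> simp

theorem sum_pairs {A : Type*} [AddCommGroup A] [Module K A]
    (f : Fin (2 * m) → Fin (2 * m) → A) :
    ∑ k : Fin m, (f (k.castLE (by omega)).rev (k.castLE (by omega)) -
      f (k.castLE (by omega)) (k.castLE (by omega)).rev) = - ∑ c, sg K c • f c c.rev := by
  have h2 : 2 * m = m + m := by omega
  have hs : ∀ g : Fin (2 * m) → A, ∑ c, g c = ∑ k : Fin m, g (k.castLE (by omega)) +
      ∑ k : Fin m, g (k.castLE (by omega)).rev := by
    intro g
    rw [← Equiv.sum_comp (finCongr h2.symm), Fin.sum_univ_add]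
    congr 1
    rw [← Equiv.sum_comp Fin.revPerm]
    refine Finset.sum_congr rfl fun k _ => congrArg g (Fin.ext ?_)
    simp [Fin.val_rev]
    omega
  have h1 : ∀ k : Fin m, sg K (k.castLE (by omega : m ≤ 2 * m)) = 1 := by
    intro k
    refine if_pos ?_
    rw [Fin.lt_def, Fin.val_rev]
    simp
    omega
  rw [hs]
  simp [sg_rev, h1]
  abel

theorem actE_apply (p q : Fin n) (i : Fin n → Fin (2 * m)) :
    actE v p q (tensorBasis v n i) = if i q = (i p).rev then
      - sg K (i p) • ∑ c, sg K c • tensorBasis v n (put p q i c c.rev) else 0 := by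
  rw [actE, Module.Basis.constr_basis,
    sum_pairs (K := K) (fun x y => tensorBasis v n (put p q i x y))]
  unfold symplEps sg
  split_ifs <;> simp_all

section Relations

variable {p q r t : Fin n}

theorem put_left {α : Type*} (i : Fin n → α) (x y : α) : put p q i x y p = x := by simp [put]

theorem put_right {α : Type*} (i : Fin n → α) (x y : α) (h : p ≠ q) : put p q i x y q = y := by
  simp [put, h.symm]

theorem put_other {α : Type*} (i : Fin n → α) (x y : α) (hp : r ≠ p) (hq : r ≠ q) :
    put p q i x y r = i r := by
  simp [put, hp, hq]

theorem put_put {α : Type*} (i : Fin n → α) (x y z w : α) :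
    put p q (put p q i x y) z w = put p q i z w := by
  funext u
  simp only [put]
  split_ifs <;> rfl

theorem put_comm {α : Type*} (i : Fin n → α) (x y z w : α) (h1 : p ≠ r) (h2 : p ≠ t) (h3 : q ≠ r)
    (h4 : q ≠ t) : put p q (put r t i x y) z w = put r t (put p q i z w) x y := by
  funext u
  simp only [put]
  split_ifs <;> simp_all

theorem put_self {α : Type*} (i : Fin n → α) : put p q i (i p) (i q) = i := by
  funext u
  simp only [put]
  split_ifs <;> simp_all

theorem rel_ss (h : p ≠ q) : actS v p q * actS v p q = 1 := by
  refine (tensorBasis v n).ext fun i => ?_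
  simp only [Module.End.mul_apply, actS_apply, map_neg, neg_neg, Module.End.one_apply, put_left,
    put_right _ _ _ h, put_put, put_self]

theorem rel_ee (h : p ≠ q) : actE v p q * actE v p q = (-(2 * (m : K))) • actE v p q := by
  refine (tensorBasis v n).ext fun i => ?_
  simp only [Module.End.mul_apply, LinearMap.smul_apply, actE_apply]
  split_ifs with h1
  · simp only [map_smul, map_sum, actE_apply, put_left, put_right _ _ _ h, put_put, if_true]
    simp only [smul_smul, mul_neg, sg_mul_self]
    rw [Finset.sum_const, Finset.card_univ, Fintype.card_fin, ← Nat.cast_smul_eq_nsmul K]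
    simp only [smul_smul]
    congr 1
    push_cast
    ring
  · simp

theorem rel_es (h : p ≠ q) : actS v p q * actE v p q = actE v p q := by
  refine (tensorBasis v n).ext fun i => ?_
  simp only [Module.End.mul_apply, actE_apply]
  split_ifs with h1
  · simp only [map_smul, map_sum, actS_apply, put_left, put_right _ _ _ h, put_put]
    congr 1
    rw [← Equiv.sum_comp Fin.revPerm]
    simp [sg_rev]
  · simp

theorem rel_se (h : p ≠ q) : actE v p q * actS v p q = actE v p q := by
  refine (tensorBasis v n).ext fun i => ?_
  simp only [Module.End.mul_apply, actS_apply, map_neg, actE_apply, put_left, put_right _ _ _ h,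
    put_put]
  by_cases h1 : i q = (i p).rev
  · simp [h1, sg_rev]
  · have : i p ≠ (i q).rev := fun h => h1 (by rw [h, Fin.rev_rev])
    simp [h1, this]

theorem rel_ss_comm (h1 : p ≠ r) (h2 : p ≠ t) (h3 : q ≠ r) (h4 : q ≠ t) :
    actS v p q * actS v r t = actS v r t * actS v p q := by
  refine (tensorBasis v n).ext fun i => ?_
  simp only [Module.End.mul_apply, actS_apply, map_neg, put_other _ _ _ h1 h2,
    put_other _ _ _ h3 h4, put_other _ _ _ h1.symm h3.symm, put_other _ _ _ h2.symm h4.symm]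
  rw [put_comm _ _ _ _ _ h1 h2 h3 h4]

theorem rel_se_comm (h1 : p ≠ r) (h2 : p ≠ t) (h3 : q ≠ r) (h4 : q ≠ t) :
    actS v p q * actE v r t = actE v r t * actS v p q := by
  refine (tensorBasis v n).ext fun i => ?_
  simp only [Module.End.mul_apply, actS_apply, actE_apply, map_neg, apply_ite (actS v p q),
    put_other _ _ _ h1.symm h3.symm, put_other _ _ _ h2.symm h4.symm, map_smul, map_sum, map_zero,
    put_other _ _ _ h1 h2, put_other _ _ _ h3 h4]
  split_ifs
  · simp only [put_comm _ _ _ _ _ h1 h2 h3 h4, smul_neg, Finset.sum_neg_distrib]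
  · simp

theorem rel_ee_comm (h1 : p ≠ r) (h2 : p ≠ t) (h3 : q ≠ r) (h4 : q ≠ t) :
    actE v p q * actE v r t = actE v r t * actE v p q := by
  refine (tensorBasis v n).ext fun i => ?_
  simp only [Module.End.mul_apply, actE_apply, apply_ite (actE v p q), apply_ite (actE v r t),
    put_other _ _ _ h1.symm h3.symm, put_other _ _ _ h2.symm h4.symm, map_smul, map_sum, map_zero,
    put_other _ _ _ h1 h2, put_other _ _ _ h3 h4]
  split_ifs
  · simp only [put_comm _ _ _ _ _ h1 h2 h3 h4, Finset.smul_sum]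
    rw [Finset.sum_comm]
    simp only [smul_smul]
    refine Finset.sum_congr rfl fun _ _ => Finset.sum_congr rfl fun _ _ => ?_
    congr 1
    ring
  · simp
  · simp
  · simp

theorem rel_braid (h1 : p ≠ q) (h2 : p ≠ r) (h3 : q ≠ r) :
    actS v p q * actS v q r * actS v p q = actS v q r * actS v p q * actS v q r := by
  refine (tensorBasis v n).ext fun i => ?_
  simp only [Module.End.mul_apply, actS_apply, map_neg]
  congr 4
  funext u
  simp only [put]
  split_ifs <;> simp_all

theorem actE_symm (h : p ≠ q) : actE v p q = actE v q p := by
  refine (tensorBasis v n).ext fun i => ?_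
  simp only [actE_apply]
  by_cases h1 : i q = (i p).rev
  · rw [if_pos h1, if_pos (by rw [h1, Fin.rev_rev]), h1, sg_rev,
      ← Equiv.sum_comp Fin.revPerm]
    simp only [Fin.revPerm_apply, sg_rev, Fin.rev_rev, neg_smul, neg_neg, smul_neg,
      Finset.sum_neg_distrib]
    congr 1
    refine Finset.sum_congr rfl fun c _ => ?_
    congr 2
    funext u
    simp only [put]
    split_ifs <;> simp_all
  · have : i p ≠ (i q).rev := fun h => h1 (by rw [h, Fin.rev_rev])
    simp [h1, this]

theorem rel_eee (h1 : p ≠ q) (h2 : p ≠ r) (h3 : q ≠ r) :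
    actE v p q * actE v q r * actE v p q = actE v p q := by
  refine (tensorBasis v n).ext fun i => ?_
  simp only [Module.End.mul_apply, actE_apply]
  split_ifs with h
  · simp only [map_smul, map_sum, actE_apply, put_right _ _ _ h1, put_other _ _ _ h2.symm h3.symm,
      Fin.rev_rev, smul_ite, smul_zero,
      put_other _ _ _ h1 h2, put_left, Finset.sum_ite_eq, Finset.sum_ite_eq', Finset.mem_univ,
      if_true]
    simp only [smul_smul, sg_rev]
    rw [show -sg K (i p) * (sg K (i r) * (- -sg K (i r) * (-sg K (i r) * -sg K (i r)))) =
      -sg K (i p) * ((sg K (i r) * sg K (i r)) * (sg K (i r) * sg K (i r))) by ring,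
      sg_mul_self, one_mul, mul_one]
    congr 1
    refine Finset.sum_congr rfl fun c _ => ?_
    congr 2
    funext u
    simp only [put]
    split_ifs <;> simp_all
  · simp

theorem rel_see (h1 : p ≠ q) (h2 : p ≠ r) (h3 : q ≠ r) :
    actE v p q * actE v q r * actS v p q = actE v p q * actS v q r := by
  refine (tensorBasis v n).ext fun i => ?_
  simp only [Module.End.mul_apply, actS_apply, map_neg, actE_apply, put_left,
    put_right _ _ _ h1, put_other _ _ _ h2.symm h3.symm, put_other _ _ _ h1 h2]
  split_ifs with h
  · simp only [map_smul, map_sum, actE_apply, put_left,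
      put_other _ _ _ h1 h2, smul_ite, smul_zero]
    have hc : ∀ c : Fin (2 * m), (c = (i q).rev) = ((i q).rev = c) := fun c => propext eq_comm
    simp only [hc, Finset.sum_ite_eq, Finset.mem_univ, if_true, smul_smul, sg_rev]
    rw [show -sg K (i p) * (-sg K (i q) * -sg K (i q)) = -sg K (i p) * (sg K (i q) * sg K (i q))
      by ring, sg_mul_self, mul_one]
    congr 2
    refine Finset.sum_congr rfl fun c _ => ?_
    congr 2
    funext u
    simp only [put]
    split_ifs <;> simp_all
  · simp

theorem rel_ees (h1 : p ≠ q) (h2 : p ≠ r) (h3 : q ≠ r) :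
    actS v q r * actE v p q * actE v q r = actS v p q * actE v q r := by
  refine (tensorBasis v n).ext fun i => ?_
  simp only [Module.End.mul_apply, actE_apply]
  split_ifs with h
  · have hc : ∀ c : Fin (2 * m), (c = (i p).rev) = ((i p).rev = c) := fun c => propext eq_comm
    simp only [map_smul, map_sum, actE_apply, put_left, put_right _ _ _ h1, actS_apply,
      put_other _ _ _ h1 h2, smul_ite, smul_zero, hc,
      Finset.sum_ite_eq, Finset.mem_univ, if_true, smul_smul, sg_rev]
    rw [show -sg K (i q) * (-sg K (i p) * -sg K (i p)) = -sg K (i q) * (sg K (i p) * sg K (i p))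
      by ring, sg_mul_self, mul_one]
    congr 1
    refine Finset.sum_congr rfl fun c _ => ?_
    congr 3
    funext u
    simp only [put]
    split_ifs <;> simp_all
  · simp
end Relations

theorem lo_eq_hi {i j : Fin (n - 1)} (h : (j : ℕ) = i + 1) : lo j = hi i := by
  simp [lo, hi, h]

theorem actGen_rel {x y : FreeAlgebra K (BrauerGen n)}
    (h : BrauerRel K n (-(2 * (m : K))) x y) :
    FreeAlgebra.lift K (fun g => MulOpposite.op (actGen v g)) x =
      FreeAlgebra.lift K (fun g => MulOpposite.op (actGen v g)) y := by
  apply MulOpposite.unop_injective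
  induction h with
  | s_sq j => simpa [actGen] using rel_ss v (lo_ne_hi j)
  | e_sq j =>
    simp only [map_smul, map_mul, FreeAlgebra.lift_ι_apply, MulOpposite.unop_mul,
      MulOpposite.unop_smul, MulOpposite.unop_op]
    exact rel_ee v (lo_ne_hi j)
  | e_s j => simpa [actGen] using rel_es v (lo_ne_hi j)
  | s_e j => simpa [actGen] using rel_se v (lo_ne_hi j)
  | s_s_comm i j h =>
    simpa [actGen] using rel_ss_comm v (p := lo j) (q := hi j) (r := lo i) (t := hi i)
      (by simp [lo, Fin.ext_iff]; omega) (by simp [lo, hi, Fin.ext_iff]; omega)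
      (by simp [lo, hi, Fin.ext_iff]; omega) (by simp [hi, Fin.ext_iff]; omega)
  | s_e_comm i j h =>
    simpa [actGen] using (rel_se_comm v (p := lo i) (q := hi i) (r := lo j) (t := hi j)
      (by simp [lo, Fin.ext_iff]; omega) (by simp [lo, hi, Fin.ext_iff]; omega)
      (by simp [lo, hi, Fin.ext_iff]; omega) (by simp [hi, Fin.ext_iff]; omega)).symm
  | e_e_comm i j h =>
    simpa [actGen] using rel_ee_comm v (p := lo j) (q := hi j) (r := lo i) (t := hi i)
      (by simp [lo, Fin.ext_iff]; omega) (by simp [lo, hi, Fin.ext_iff]; omega)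
      (by simp [lo, hi, Fin.ext_iff]; omega) (by simp [hi, Fin.ext_iff]; omega)
  | braid i j h =>
    have h1 := lo_ne_hi i
    have h2 : lo i ≠ hi j := by simp [lo, hi, Fin.ext_iff]; omega
    have h3 := lo_ne_hi j
    rw [lo_eq_hi h] at h3
    simpa [actGen, lo_eq_hi h, mul_assoc] using rel_braid v h1 h2 h3
  | e_e_e i j h =>
    have h1 := lo_ne_hi i
    have h2 : lo i ≠ hi j := by simp [lo, hi, Fin.ext_iff]; omega
    have h3 := lo_ne_hi j
    rw [lo_eq_hi h] at h3
    simpa [actGen, lo_eq_hi h, mul_assoc] using rel_eee v h1 h2 h3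
  | e_e_e' i j h =>
    have h1 := lo_ne_hi i
    have h2 : lo i ≠ hi j := by simp [lo, hi, Fin.ext_iff]; omega
    have h3 := lo_ne_hi j
    rw [lo_eq_hi h] at h3
    have := rel_eee v h3.symm h2.symm h1.symm
    rw [← actE_symm v h1, ← actE_symm v h3] at this
    simpa [actGen, lo_eq_hi h, mul_assoc] using this
  | s_e_e i j h =>
    have h1 := lo_ne_hi i
    have h2 : lo i ≠ hi j := by simp [lo, hi, Fin.ext_iff]; omega
    have h3 := lo_ne_hi j
    rw [lo_eq_hi h] at h3
    simpa [actGen, lo_eq_hi h, mul_assoc] using rel_see v h1 h2 h3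
  | e_e_s i j h =>
    have h1 := lo_ne_hi i
    have h2 : lo i ≠ hi j := by simp [lo, hi, Fin.ext_iff]; omega
    have h3 := lo_ne_hi j
    rw [lo_eq_hi h] at h3
    simpa [actGen, lo_eq_hi h, mul_assoc] using rel_ees v h1 h2 h3

variable (n)

/-- The homomorphism `φ` from the opposite of the Brauer algebra with parameter `-2m` to the
endomorphisms of `V^{⊗n}`: the right action determined by the action of the generators. -/
noncomputable def phi :
    (BrauerAlgebra K n (-(2 * (m : K))))ᵐᵒᵖ →ₐ[K] Module.End K (⨂[K] _ : Fin n, V) :=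
  AlgHom.opComm (RingQuot.liftAlgHom K
    ⟨FreeAlgebra.lift K (fun g => MulOpposite.op (actGen v g)), fun _ _ h => actGen_rel v h⟩)

theorem phi_s (j : Fin (n - 1)) :
    phi v n (MulOpposite.op (BrauerAlgebra.s j)) = actS v (lo j) (hi j) := by
  simp [phi, BrauerAlgebra.s, AlgHom.opComm, actGen]

theorem phi_e (j : Fin (n - 1)) :
    phi v n (MulOpposite.op (BrauerAlgebra.e j)) = actE v (lo j) (hi j) := by
  simp [phi, BrauerAlgebra.e, AlgHom.opComm, actGen]

end Action

/-!
The coefficient of `v_{j_1} ⊗ ⋯ ⊗ v_{j_n}` in the image of `v_{i_1} ⊗ ⋯ ⊗ v_{i_n}` under a Brauer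
diagram `D` is, up to a sign depending on `j` only, one term of a Pfaffian. Label the top vertices
by `i` and the bottom vertices by the dual indices `j'`. Choose a permutation `σ` of the vertices
that carries the vertical edges to the edges of `D` (a *frame*). Then the coefficient is
`sign σ * ∏ k, ε (σ (inl k)) (σ (inr k))`, with `ε` evaluated at the labels
(`phi_apply_of_represents`). Two frames of `D` differ by an element of the hyperoctahedral group,
so this expression depends on `D` only (`BrauerDiagram.IsFrame.pfaffianTerm_eq`). Since the sign of
`s_j` on tensor space is `-1`, stacking on top of `s_j`, and likewise on top of `e_j` when no loop
arises, amounts to exchanging two vertices of `D`, which changes the sign of `σ`.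

The diagrams in `BD_n(a,b)` run through all perfect matchings of `a + b` vertices, the other edges
being fixed. Hence the coefficients of their sum are multiples of Pfaffians of Gram matrices of
`a + b > 2m` basis vectors. Two of these vectors coincide, and exchanging the corresponding vertices
pairs off the terms with opposite signs (`BrauerDiagram.sum_BD_pfaffianTerm`).
-/

/-! ### Pfaffian terms -/

theorem symplEps_eq {K : Type*} [CommRing K] {m : ℕ} (x y : Fin (2 * m)) :
    symplEps K x y = if y = x.rev then sg K x else 0 := by
  unfold symplEps sg
  split_ifs <;> simp_all

theorem symplEps_swap {K : Type*} [CommRing K] {m : ℕ} (x y : Fin (2 * m)) :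
    symplEps K y x = -symplEps K x y := by
  simp only [symplEps_eq]
  by_cases h : y = x.rev
  · simp [h, sg_rev]
  · have : x ≠ y.rev := fun e => h (by rw [e, Fin.rev_rev])
    simp [h, this]

theorem symplEps_self {K : Type*} [CommRing K] {m : ℕ} (x : Fin (2 * m)) :
    symplEps K x x = 0 := by
  have : x ≠ x.rev := by
    intro h
    have := congrArg Fin.val h
    rw [Fin.val_rev] at this
    omega
  simp [symplEps_eq, this]

section PfaffianTerm

variable {K : Type*} [CommRing K] {m : ℕ} {ι : Type*} [Fintype ι] [DecidableEq ι]

/-- The signed term of the Pfaffian of the Gram matrix of the basis vectors with indices `l`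
belonging to the perfect matching with the edges `σ (inl k) — σ (inr k)`. -/
def pfaffianTerm (K : Type*) [CommRing K] {m : ℕ} {ι : Type*} [Fintype ι] [DecidableEq ι]
    (σ : Equiv.Perm (ι ⊕ ι)) (l : ι ⊕ ι → Fin (2 * m)) : K :=
  ((Equiv.Perm.sign σ : ℤ) : K) * ∏ k, symplEps K (l (σ (Sum.inl k))) (l (σ (Sum.inr k)))

theorem pfaffianTerm_mul (τ σ : Equiv.Perm (ι ⊕ ι)) (l : ι ⊕ ι → Fin (2 * m)) :
    pfaffianTerm K (τ * σ) l =
      ((Equiv.Perm.sign τ : ℤ) : K) * pfaffianTerm K σ (fun x => l (τ x)) := by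
  simp [pfaffianTerm, mul_assoc]

theorem pfaffianTerm_mul_flip (σ : Equiv.Perm (ι ⊕ ι)) (l : ι ⊕ ι → Fin (2 * m)) (k : ι) :
    pfaffianTerm K (σ * Equiv.swap (Sum.inl k) (Sum.inr k)) l = pfaffianTerm K σ l := by
  have h : ∀ c ∈ Finset.univ.erase k,
      symplEps K (l ((σ * Equiv.swap (Sum.inl k) (Sum.inr k)) (Sum.inl c)))
        (l ((σ * Equiv.swap (Sum.inl k) (Sum.inr k)) (Sum.inr c))) =
      symplEps K (l (σ (Sum.inl c))) (l (σ (Sum.inr c))) := by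
    intro c hc
    have hc := Finset.ne_of_mem_erase hc
    rw [Equiv.Perm.mul_apply, Equiv.Perm.mul_apply, Equiv.swap_apply_of_ne_of_ne,
      Equiv.swap_apply_of_ne_of_ne] <;> simp [hc]
  unfold pfaffianTerm
  rw [← Finset.mul_prod_erase _ _ (Finset.mem_univ k), Finset.prod_congr rfl h,
    ← Finset.mul_prod_erase _ _ (Finset.mem_univ k)]
  simp only [Equiv.Perm.mul_apply, Equiv.swap_apply_left, Equiv.swap_apply_right]
  rw [symplEps_swap, Equiv.Perm.sign_mul, Equiv.Perm.sign_swap (by simp)]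
  push_cast
  ring

/-- The hyperoctahedral group acts trivially: flipping an edge changes the sign of the permutation
and of one factor, and permuting the edges is an even permutation of the vertices. -/
theorem pfaffianTerm_of_swap (ρ : Equiv.Perm (ι ⊕ ι)) (l : ι ⊕ ι → Fin (2 * m))
    (h : ∀ k, ρ (Sum.inr k) = (ρ (Sum.inl k)).swap) :
    pfaffianTerm K ρ l = pfaffianTerm K 1 l := by
  induction hc : (Finset.univ.filter fun k => (ρ (Sum.inl k)).isRight).card
    using Nat.strong_induction_on generalizing ρ with
  | _ c ih =>
  by_cases hr : ∃ k, (ρ (Sum.inl k)).isRight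
  · obtain ⟨k, hk⟩ := hr
    have hne : ∀ c ≠ k, (ρ * Equiv.swap (Sum.inl k) (Sum.inr k)) (Sum.inl c) = ρ (Sum.inl c) ∧
        (ρ * Equiv.swap (Sum.inl k) (Sum.inr k)) (Sum.inr c) = ρ (Sum.inr c) := by
      intro c hc
      constructor <;> rw [Equiv.Perm.mul_apply, Equiv.swap_apply_of_ne_of_ne] <;> simp [hc]
    rw [← pfaffianTerm_mul_flip ρ l k]
    refine ih _ ?_ _ ?_ rfl
    · rw [← hc]
      apply Finset.card_lt_card
      rw [Finset.ssubset_iff_of_subset]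
      · refine ⟨k, by simp [hk], ?_⟩
        rw [Finset.mem_filter]
        simpa [h] using hk
      · intro c
        rcases eq_or_ne c k with rfl | hck
        · simp [hk]
        · simp [-Equiv.Perm.coe_mul, (hne c hck).1]
    · intro c
      rcases eq_or_ne c k with rfl | hck
      · simp [h]
      · rw [(hne c hck).1, (hne c hck).2, h]
  · have hl : Set.MapsTo ρ (Set.range Sum.inl) (Set.range Sum.inl) := by
      rintro _ ⟨k, rfl⟩
      rcases hz : ρ (Sum.inl k) with z | z
      · exact ⟨z, rfl⟩
      · exact absurd ⟨k, by simp [hz]⟩ hr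
    obtain ⟨⟨π, π'⟩, rfl⟩ := Equiv.Perm.mem_sumCongrHom_range_of_perm_mapsTo_inl hl
    obtain rfl : π' = π := by
      ext k
      simpa using h k
    simp only [pfaffianTerm, Equiv.Perm.sumCongrHom_apply, Equiv.Perm.sign_sumCongr,
      Equiv.Perm.sumCongr_apply, Sum.map_inl, Sum.map_inr, Int.units_mul_self]
    rw [Equiv.prod_comp π' fun k => symplEps K (l (Sum.inl k)) (l (Sum.inr k))]
    simp

end PfaffianTerm

namespace BrauerDiagram

variable {n : ℕ}

/-- A permutation `σ` of the vertices carrying the vertical edges to the edges of `D`, that is, an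
enumeration of the edges of `D` together with an orientation of each of them. -/
def IsFrame (D : BrauerDiagram n) (σ : Equiv.Perm (Fin n ⊕ Fin n)) : Prop :=
  ∀ k, D.1 (σ (Sum.inl k)) = σ (Sum.inr k)

theorem IsFrame.inr {D : BrauerDiagram n} {σ : Equiv.Perm (Fin n ⊕ Fin n)} (h : D.IsFrame σ)
    (k : Fin n) : D.1 (σ (Sum.inr k)) = σ (Sum.inl k) := by
  rw [← h k, D.2.1]

theorem IsFrame.swap {D : BrauerDiagram n} {σ : Equiv.Perm (Fin n ⊕ Fin n)} (h : D.IsFrame σ)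
    (x : Fin n ⊕ Fin n) : σ x.swap = D.1 (σ x) := by
  rcases x with k | k
  · exact (h k).symm
  · exact (h.inr k).symm

theorem IsFrame.pfaffianTerm_eq {K : Type*} [CommRing K] {m : ℕ} {D : BrauerDiagram n}
    {σ σ' : Equiv.Perm (Fin n ⊕ Fin n)} (h : D.IsFrame σ) (h' : D.IsFrame σ')
    (l : Fin n ⊕ Fin n → Fin (2 * m)) : pfaffianTerm K σ l = pfaffianTerm K σ' l := by
  rw [← mul_inv_cancel_left σ' σ, pfaffianTerm_mul, pfaffianTerm_of_swap, ← pfaffianTerm_mul,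
    mul_one]
  intro k
  apply σ'.injective
  rw [h'.swap]
  simp [h k]

/-- The diagram obtained by exchanging the vertices `x` and `y`. -/
def exchange (D : BrauerDiagram n) (x y : Fin n ⊕ Fin n) : BrauerDiagram n :=
  ⟨fun z => Equiv.swap x y (D.1 (Equiv.swap x y z)), by intro z; simp [D.2.1], by
    intro z h
    rw [Equiv.swap_apply_eq_iff] at h
    exact D.2.2 _ h⟩

theorem exchange_apply (D : BrauerDiagram n) (x y z : Fin n ⊕ Fin n) :
    (D.exchange x y).1 z = Equiv.swap x y (D.1 (Equiv.swap x y z)) := rfl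

theorem exchange_exchange (D : BrauerDiagram n) (x y : Fin n ⊕ Fin n) :
    (D.exchange x y).exchange x y = D := by
  refine Subtype.ext (funext fun z => ?_)
  simp [exchange_apply]

theorem IsFrame.exchange {D : BrauerDiagram n} {σ : Equiv.Perm (Fin n ⊕ Fin n)} (h : D.IsFrame σ)
    (x y : Fin n ⊕ Fin n) : (D.exchange x y).IsFrame (Equiv.swap x y * σ) := by
  intro k
  simp [exchange_apply, h k]

theorem mulS_eq_exchange (D : BrauerDiagram n) (p q : Fin n) :
    D.mulS p q = D.exchange (Sum.inr p) (Sum.inr q) := rfl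

theorem mulE_eq_exchange (D : BrauerDiagram n) (p q : Fin n) (h : p ≠ q)
    (hD : D.1 (Sum.inr p) ≠ Sum.inr q) :
    D.mulE p q h = D.exchange (Sum.inr p) (D.1 (Sum.inr q)) := by
  refine Subtype.ext (funext fun z => ?_)
  have hp := D.2.1 (Sum.inr p)
  have hq := D.2.1 (Sum.inr q)
  have hpq : (Sum.inr p : Fin n ⊕ Fin n) ≠ Sum.inr q := by simpa using h
  simp only [mulE, exchange_apply, Equiv.swap_apply_def]
  grind

theorem isFrame_one : (one n).IsFrame 1 := fun _ => rfl

theorem exists_isFrame (D : BrauerDiagram n) : ∃ σ, D.IsFrame σ := by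
  obtain ⟨y, hy⟩ := BrauerAlgebra.exists_represents (K := ℤ) (δ := 0) D
  induction hy with
  | one => exact ⟨1, isFrame_one⟩
  | mul_s _ j ih =>
    obtain ⟨σ, hσ⟩ := ih
    exact ⟨_, hσ.exchange _ _⟩
  | mul_e _ j hj ih =>
    obtain ⟨σ, hσ⟩ := ih
    rw [mulE_eq_exchange _ _ _ _ hj]
    exact ⟨_, hσ.exchange _ _⟩

theorem IsFrame.mul_flip {D : BrauerDiagram n} {σ : Equiv.Perm (Fin n ⊕ Fin n)} (h : D.IsFrame σ)
    (k : Fin n) : D.IsFrame (σ * Equiv.swap (Sum.inl k) (Sum.inr k)) := by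
  intro c
  rcases eq_or_ne c k with rfl | hc
  · simp [h.inr]
  · rw [Equiv.Perm.mul_apply, Equiv.Perm.mul_apply, Equiv.swap_apply_of_ne_of_ne,
      Equiv.swap_apply_of_ne_of_ne, h] <;> simp [hc]

theorem exists_isFrame_two (D : BrauerDiagram n) (x y : Fin n ⊕ Fin n) (hxy : x ≠ y)
    (hD : D.1 x ≠ y) : ∃ σ, D.IsFrame σ ∧ ∃ k c, k ≠ c ∧ σ (Sum.inl k) = x ∧ σ (Sum.inl c) = y := by
  have flip : ∀ σ, D.IsFrame σ → ∀ z, ∃ τ, D.IsFrame τ ∧ (∃ k, τ (Sum.inl k) = z) ∧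
      ∀ c, σ (Sum.inl c) ≠ z → σ (Sum.inr c) ≠ z → τ (Sum.inl c) = σ (Sum.inl c) := by
    intro σ hσ z
    obtain ⟨k | k, hk⟩ := σ.surjective z
    · exact ⟨σ, hσ, ⟨k, hk⟩, fun _ _ _ => rfl⟩
    · refine ⟨_, hσ.mul_flip k, ⟨k, by simp [hk]⟩, fun c h1 h2 => ?_⟩
      have : c ≠ k := by
        rintro rfl
        exact h2 hk
      rw [Equiv.Perm.mul_apply, Equiv.swap_apply_of_ne_of_ne] <;> simp [this]
  obtain ⟨σ, hσ⟩ := D.exists_isFrame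
  obtain ⟨τ, hτ, ⟨k, hk⟩, -⟩ := flip σ hσ x
  obtain ⟨υ, hυ, ⟨c, hc⟩, h⟩ := flip τ hτ y
  have hk' := h k (by rwa [hk]) (by rwa [← hτ k, hk])
  rw [hk] at hk'
  refine ⟨υ, hυ, k, c, ?_, hk', hc⟩
  rintro rfl
  exact hxy (hk'.symm.trans hc)

/-- Exchanging two vertices of the diagram together with their labels changes the sign of the
Pfaffian term. -/
theorem IsFrame.pfaffianTerm_exchange {K : Type*} [CommRing K] {m : ℕ} {D : BrauerDiagram n}
    {σ σ' : Equiv.Perm (Fin n ⊕ Fin n)} {x y : Fin n ⊕ Fin n} (h : D.IsFrame σ)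
    (h' : (D.exchange x y).IsFrame σ') (hxy : x ≠ y) (l : Fin n ⊕ Fin n → Fin (2 * m)) :
    pfaffianTerm K σ' l = -pfaffianTerm K σ (fun z => l (Equiv.swap x y z)) := by
  rw [h'.pfaffianTerm_eq (h.exchange x y), pfaffianTerm_mul, Equiv.Perm.sign_swap hxy]
  simp

theorem IsFrame.pfaffianTerm_eq_zero {K : Type*} [CommRing K] {m : ℕ} {D : BrauerDiagram n}
    {σ : Equiv.Perm (Fin n ⊕ Fin n)} (h : D.IsFrame σ) (l : Fin n ⊕ Fin n → Fin (2 * m))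
    (x : Fin n ⊕ Fin n) (hl : l (D.1 x) = l x) : pfaffianTerm K σ l = 0 := by
  obtain ⟨k | k, rfl⟩ := σ.surjective x
  · rw [h k] at hl
    rw [pfaffianTerm, Finset.prod_eq_zero (Finset.mem_univ k), mul_zero]
    rw [hl, symplEps_self]
  · rw [h.inr k] at hl
    rw [pfaffianTerm, Finset.prod_eq_zero (Finset.mem_univ k), mul_zero]
    rw [hl, symplEps_self]

end BrauerDiagram

/-! ### Matrix coefficients of diagrams on tensor space -/

section Coefficients

variable {K : Type*} [CommRing K] {m n : ℕ}

/-- The labelling of the vertices that belongs to the matrix coefficient at `(i, j)`. The bottom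
labels are reversed because `v_{c'}` is, up to sign, dual to `v_c` under the form. -/
def vertexLabel (i j : Fin n → Fin (2 * m)) : Fin n ⊕ Fin n → Fin (2 * m) :=
  Sum.elim i fun k => (j k).rev

theorem prod_sg_put {p q : Fin n} (h : p ≠ q) (j : Fin n → Fin (2 * m)) (x : Fin (2 * m)) :
    ∏ k, sg K (put p q j x x.rev k) = -∏ k ∈ (Finset.univ.erase p).erase q, sg K (j k) := by
  rw [← Finset.mul_prod_erase _ _ (Finset.mem_univ p), ← Finset.mul_prod_erase _ _
    (Finset.mem_erase.2 ⟨h.symm, Finset.mem_univ q⟩), put_left, put_right _ _ _ h, sg_rev,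
    ← mul_assoc, mul_neg, sg_mul_self, neg_one_mul]
  congr 1
  refine Finset.prod_congr rfl fun k hk => ?_
  simp only [Finset.mem_erase] at hk
  rw [put_other _ _ _ hk.2.1 hk.1]

theorem pfaffianTerm_eq_mul {ι : Type*} [Fintype ι] [DecidableEq ι] {k c : ι} (h : k ≠ c)
    (σ : Equiv.Perm (ι ⊕ ι)) (l : ι ⊕ ι → Fin (2 * m)) :
    pfaffianTerm K σ l = ((Equiv.Perm.sign σ : ℤ) : K) *
      (symplEps K (l (σ (Sum.inl k))) (l (σ (Sum.inr k))) *
      (symplEps K (l (σ (Sum.inl c))) (l (σ (Sum.inr c))) *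
      ∏ t ∈ (Finset.univ.erase k).erase c,
        symplEps K (l (σ (Sum.inl t))) (l (σ (Sum.inr t))))) := by
  rw [Finset.mul_prod_erase _ (fun t => symplEps K (l (σ (Sum.inl t))) (l (σ (Sum.inr t))))
    (Finset.mem_erase.2 ⟨h.symm, Finset.mem_univ c⟩),
    Finset.mul_prod_erase _ (fun t => symplEps K (l (σ (Sum.inl t))) (l (σ (Sum.inr t))))
    (Finset.mem_univ k), pfaffianTerm]

/-- The form is recovered by inserting the canonical tensor between two copies of it. -/
theorem sum_sg_mul_symplEps (y z : Fin (2 * m)) :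
    ∑ x, sg K x * (symplEps K x.rev y * symplEps K x z) = symplEps K z y := by
  rw [Finset.sum_eq_single y]
  · rw [symplEps_swap y z, symplEps_eq y.rev y, if_pos (Fin.rev_rev y).symm, sg_rev]
    linear_combination (-symplEps K y z) * sg_mul_self (K := K) y
  · intro x _ hx
    rw [symplEps_eq x.rev y, Fin.rev_rev, if_neg hx.symm]
    simp
  · simp

/-- Stacking on top of `e`: the coefficients of `D.mulE p q` in terms of those of `D`. -/
theorem BrauerDiagram.IsFrame.coeff_mulE {D : BrauerDiagram n} {p q : Fin n} (h : p ≠ q)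
    (hD : D.1 (Sum.inr p) ≠ Sum.inr q) {σ σ' : Equiv.Perm (Fin n ⊕ Fin n)} (hσ : D.IsFrame σ)
    (hσ' : (D.mulE p q h).IsFrame σ') (i j : Fin n → Fin (2 * m)) :
    (∏ k, sg K (j k)) * pfaffianTerm K σ' (vertexLabel i j) =
      if j q = (j p).rev then ∑ x, (∏ k, sg K (put p q j x x.rev k)) *
        pfaffianTerm K σ (vertexLabel i (put p q j x x.rev)) * (-sg K x * sg K (j p))
      else 0 := by
  obtain ⟨τ, hτ, k, c, hkc, hk, hc⟩ := D.exists_isFrame_two (Sum.inr p) (Sum.inr q)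
    (by simpa using h) hD
  have hk' := hτ k
  have hc' := hτ c
  rw [hk] at hk'
  rw [hc] at hc'
  have hpw : Sum.inr p ≠ τ (Sum.inr c) := by rw [← hk]; simp
  have hpu : Sum.inr p ≠ τ (Sum.inr k) := by rw [← hk]; simp
  have hqw : Sum.inr q ≠ τ (Sum.inr c) := by rw [← hc]; simp
  have hqu : Sum.inr q ≠ τ (Sum.inr k) := by rw [← hc]; simp
  have huw : τ (Sum.inr k) ≠ τ (Sum.inr c) := by simpa using hkc
  have hpq : (Sum.inr p : Fin n ⊕ Fin n) ≠ Sum.inr q := by simpa using h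
  rw [BrauerDiagram.mulE_eq_exchange _ _ _ _ hD, hc'] at hσ'
  -- Away from `p` and `q`, the labels do not depend on the summation index.
  have hl : ∀ x z, z ≠ Sum.inr p → z ≠ Sum.inr q →
      vertexLabel i (put p q j x x.rev) z = vertexLabel i j z := by
    rintro x (z | z) h1 h2
    · rfl
    · simp [vertexLabel, put_other (r := z) j x x.rev (by simpa using h1) (by simpa using h2)]
  have hlp : ∀ x, vertexLabel i (put p q j x x.rev) (Sum.inr p) = x.rev := fun x => by
    simp [vertexLabel, put_left]
  have hlq : ∀ x, vertexLabel i (put p q j x x.rev) (Sum.inr q) = x := fun x => by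
    simp [vertexLabel, put_right _ _ _ h]
  set R : K := ∏ t ∈ (Finset.univ.erase k).erase c, symplEps K
    (vertexLabel i j (τ (Sum.inl t))) (vertexLabel i j (τ (Sum.inr t)))
  have h1 : ∀ x, pfaffianTerm K σ (vertexLabel i (put p q j x x.rev)) =
      ((Equiv.Perm.sign τ : ℤ) : K) * (symplEps K x.rev (vertexLabel i j (τ (Sum.inr k))) *
        (symplEps K x (vertexLabel i j (τ (Sum.inr c))) * R)) := by
    intro x
    rw [hσ.pfaffianTerm_eq hτ, pfaffianTerm_eq_mul hkc, hk, hc, hlp, hlq,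
      hl x _ hpu.symm hqu.symm, hl x _ hpw.symm hqw.symm]
    congr 3
    refine Finset.prod_congr rfl fun t ht => ?_
    simp only [Finset.mem_erase] at ht
    rw [hl, hl]
    all_goals first | rw [← hk] | rw [← hc]
    all_goals simp [ht.1, ht.2.1]
  have h2 : pfaffianTerm K σ' (vertexLabel i j) = -((Equiv.Perm.sign τ : ℤ) : K) *
      (symplEps K (vertexLabel i j (τ (Sum.inr c))) (vertexLabel i j (τ (Sum.inr k))) *
        (symplEps K (j q).rev (j p).rev * R)) := by
    rw [hτ.pfaffianTerm_exchange hσ' hpw, pfaffianTerm_eq_mul hkc, hk, hc,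
      Equiv.swap_apply_left, Equiv.swap_apply_right,
      Equiv.swap_apply_of_ne_of_ne hpq.symm hqw,
      Equiv.swap_apply_of_ne_of_ne hpu.symm huw, neg_mul]
    congr 4
    refine Finset.prod_congr rfl fun t ht => ?_
    simp only [Finset.mem_erase] at ht
    rw [Equiv.swap_apply_of_ne_of_ne, Equiv.swap_apply_of_ne_of_ne]
    all_goals first | rw [← hk] | skip
    all_goals simp [ht.1, ht.2.1]
  rw [h2]
  split_ifs with hj
  · have h3 : ∏ k, sg K (j k) = -∏ k ∈ (Finset.univ.erase p).erase q, sg K (j k) := by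
      rw [← prod_sg_put h j (j p), ← hj, put_self]
    simp only [h1, prod_sg_put h, h3]
    rw [← sum_sg_mul_symplEps, hj, Fin.rev_rev, symplEps_eq (j p) (j p).rev, if_pos rfl,
      Finset.sum_mul, Finset.mul_sum, Finset.mul_sum]
    exact Finset.sum_congr rfl fun x _ => by ring
  · rw [symplEps_eq (j q).rev, if_neg]
    · simp
    · rw [Fin.rev_rev]
      exact fun e => hj e.symm

end Coefficients

section Representation

variable {K : Type*} [CommRing K] {m n : ℕ} {V : Type*} [AddCommGroup V] [Module K V]
  (v : Module.Basis (Fin (2 * m)) K V)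

/-- The output of `actE` in coordinates: it is supported on the `j` whose entries at `p` and `q` are
opposite, and its coefficient there contracts `f` over all opposite entries at `p` and `q`. -/
theorem actE_sum {p q : Fin n} (h : p ≠ q) (f : (Fin n → Fin (2 * m)) → K) :
    actE v p q (∑ j, f j • tensorBasis v n j) = ∑ j, (if j q = (j p).rev then
      ∑ x, f (put p q j x x.rev) * (-sg K x * sg K (j p)) else 0) • tensorBasis v n j := by
  simp only [map_sum, map_smul, actE_apply, ite_smul, zero_smul, smul_ite, smul_zero]
  rw [← Finset.sum_filter, ← Finset.sum_filter]
  simp only [Finset.smul_sum, Finset.sum_smul]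
  rw [← Finset.sum_product', ← Finset.sum_product']
  refine Finset.sum_nbij' (fun a => (put p q a.1 a.2 a.2.rev, a.1 p))
    (fun a => (put p q a.1 a.2 a.2.rev, a.1 p)) ?_ ?_ ?_ ?_ ?_
  · simp [put_left, put_right _ _ _ h]
  · simp [put_left, put_right _ _ _ h]
  · rintro ⟨j, c⟩ hj
    have hj : j q = (j p).rev := by simpa using hj
    simp [put_left, put_put, ← hj, put_self]
  · rintro ⟨j, c⟩ hj
    have hj : j q = (j p).rev := by simpa using hj
    simp [put_left, put_put, ← hj, put_self]
  · rintro ⟨j, c⟩ hj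
    have hj : j q = (j p).rev := by simpa using hj
    simp only [put_left, put_put, ← hj, put_self, smul_smul]

theorem actS_sum {p q : Fin n} (f : (Fin n → Fin (2 * m)) → K) :
    actS v p q (∑ j, f j • tensorBasis v n j) =
      ∑ j, (-f (j ∘ Equiv.swap p q)) • tensorBasis v n j := by
  simp only [map_sum, map_smul, actS_apply]
  have h : ∀ j : Fin n → Fin (2 * m), put p q j (j q) (j p) = j ∘ Equiv.swap p q := by
    intro j
    funext r
    simp only [put, Function.comp_apply, Equiv.swap_apply_def]
    split_ifs <;> rfl
  refine Fintype.sum_equiv ((Equiv.swap p q).arrowCongr (Equiv.refl _)) _ _ fun j => ?_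
  simp [h, Equiv.arrowCongr, Function.comp_def]

/-- The matrix of a Brauer diagram on tensor space: up to the signs `sg (j k)` of dualizing the
bottom row, its coefficients are terms of Pfaffians. -/
theorem phi_apply_of_represents {D : BrauerDiagram n}
    {y : BrauerAlgebra K n (-(2 * (m : K)))} (hy : BrauerAlgebra.Represents D y)
    {σ : Equiv.Perm (Fin n ⊕ Fin n)} (hσ : D.IsFrame σ) (i : Fin n → Fin (2 * m)) :
    phi v n (MulOpposite.op y) (tensorBasis v n i) =
      ∑ j, ((∏ k, sg K (j k)) * pfaffianTerm K σ (vertexLabel i j)) • tensorBasis v n j := by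
  induction hy generalizing σ with
  | one =>
    simp only [hσ.pfaffianTerm_eq BrauerDiagram.isFrame_one]
    rw [Finset.sum_eq_single i]
    · have : (∏ k, sg K (i k)) * ∏ k, sg K (i k) = 1 := by
        simp [← Finset.prod_mul_distrib, sg_mul_self]
      simp [pfaffianTerm, vertexLabel, symplEps_eq, this]
    · intro j _ hj
      obtain ⟨k, hk⟩ := Function.ne_iff.1 hj
      have : ∏ k, symplEps K (i k) (j k).rev = 0 :=
        Finset.prod_eq_zero (Finset.mem_univ k) (by simp [symplEps_eq, hk])
      simp [pfaffianTerm, vertexLabel, this]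
    · simp
  | @mul_s D y _ t ih =>
    obtain ⟨σ₀, hσ₀⟩ := D.exists_isFrame
    rw [MulOpposite.op_mul, map_mul, Module.End.mul_apply, ih hσ₀, phi_s, actS_sum]
    refine Finset.sum_congr rfl fun j _ => ?_
    rw [BrauerDiagram.mulS_eq_exchange] at hσ
    rw [hσ₀.pfaffianTerm_exchange hσ (by simpa using lo_ne_hi t), mul_neg]
    congr 3
    · exact Equiv.prod_comp (Equiv.swap (lo t) (hi t)) fun k => sg K (j k)
    · congr 1
      funext z
      rcases z with z | z
      · rw [Equiv.swap_apply_of_ne_of_ne] <;> simp [vertexLabel]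
      · simp only [vertexLabel, Sum.elim_inr, Function.comp_apply, Equiv.swap_apply_def,
          Sum.inr.injEq]
        split_ifs <;> rfl
  | @mul_e D y _ t ht ih =>
    obtain ⟨σ₀, hσ₀⟩ := D.exists_isFrame
    rw [MulOpposite.op_mul, map_mul, Module.End.mul_apply, ih hσ₀, phi_e,
      actE_sum v (lo_ne_hi t)]
    exact Finset.sum_congr rfl fun j _ => by rw [hσ₀.coeff_mulE (lo_ne_hi t) ht hσ]

end Representation

/-! ### Vanishing of the sum over `BD_n(a,b)` -/

namespace BrauerDiagram

variable {n a b : ℕ}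

/-- The first `a` top vertices and the first `b` bottom vertices. -/
def InitialVertex (a b : ℕ) : Fin n ⊕ Fin n → Prop :=
  Sum.elim (fun i => (i : ℕ) < a) fun i => (i : ℕ) < b

theorem IsBD.exchange {D : BrauerDiagram n} (hD : IsBD a b D) {x y : Fin n ⊕ Fin n}
    (hx : InitialVertex a b x) (hy : InitialVertex a b y) : IsBD a b (D.exchange x y) := by
  obtain ⟨h1, h2, h3, h4⟩ := hD
  have hmem : ∀ z, InitialVertex a b z → InitialVertex a b (Equiv.swap x y z) := by
    intro z hz
    rw [Equiv.swap_apply_def]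
    split_ifs <;> assumption
  have hfix : ∀ z, ¬InitialVertex a b z → Equiv.swap x y z = z := by
    intro z hz
    refine Equiv.swap_apply_of_ne_of_ne ?_ ?_ <;> rintro rfl <;> contradiction
  have hedge : ∀ z w, ¬InitialVertex a b z → ¬InitialVertex a b w → D.1 z = w →
      (D.exchange x y).1 z = w := by
    intro z w hz hw e
    rw [exchange_apply, hfix z hz, e, hfix w hw]
  refine ⟨fun z hz => hmem _ (h1 _ (hmem _ hz)), fun i hi => hedge _ _ ?_ ?_ (h2 i hi),
    fun t ht p q hp hq => hedge _ _ ?_ ?_ (h3 t ht p q hp hq),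
    fun t ht p q hp hq => hedge _ _ ?_ ?_ (h4 t ht p q hp hq)⟩
  all_goals simp only [InitialVertex, Sum.elim_inl, Sum.elim_inr]; omega

theorem exists_ne_initialVertex_eq {m : ℕ} (ha : a ≤ n) (hb : b ≤ n) (h : 2 * m < a + b)
    (l : Fin n ⊕ Fin n → Fin (2 * m)) :
    ∃ x y, x ≠ y ∧ InitialVertex a b x ∧ InitialVertex a b y ∧ l x = l y := by
  let g : Fin a ⊕ Fin b → Fin n ⊕ Fin n := Sum.map (Fin.castLE ha) (Fin.castLE hb)
  have hg : g.Injective := (Fin.castLE_injective ha).sumMap (Fin.castLE_injective hb)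
  have hg' : ∀ z, InitialVertex a b (g z) := by rintro (z | z) <;> simp [g, InitialVertex]
  obtain ⟨z, w, hzw, e⟩ := Fintype.exists_ne_map_eq_of_card_lt (fun z => l (g z)) (by simpa using h)
  exact ⟨g z, g w, hg.ne hzw, hg' z, hg' w, e⟩

/-- The Pfaffian of the Gram matrix of more than `2m` basis vectors vanishes: two of them coincide,
and exchanging these two pairs off the terms with opposite signs, except for the terms containing
the form at the coinciding vectors, which are zero. -/
theorem sum_BD_pfaffianTerm {K : Type*} [CommRing K] {m : ℕ} (ha : a ≤ n) (hb : b ≤ n)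
    (h : 2 * m < a + b) (σ : BrauerDiagram n → Equiv.Perm (Fin n ⊕ Fin n))
    (hσ : ∀ D : BrauerDiagram n, D.IsFrame (σ D)) (l : Fin n ⊕ Fin n → Fin (2 * m)) :
    ∑ D ∈ BD n a b, pfaffianTerm K (σ D) l = 0 := by
  obtain ⟨x, y, hxy, hx, hy, hl⟩ := exists_ne_initialVertex_eq ha hb h l
  refine Finset.sum_involution (fun D _ => D.exchange x y) ?_ ?_ ?_ ?_
  · intro D _
    have : (fun z => l (Equiv.swap x y z)) = l := by
      funext z
      rw [Equiv.swap_apply_def]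
      split_ifs <;> simp_all
    rw [(hσ D).pfaffianTerm_exchange (hσ _) hxy, this, add_neg_cancel]
  · intro D _ hD e
    refine hD ((hσ D).pfaffianTerm_eq_zero l x ?_)
    -- A diagram fixed by the exchange joins `x` and `y`.
    have h1 := congrArg (fun E : BrauerDiagram n => E.1 x) e
    simp only [exchange_apply, Equiv.swap_apply_left] at h1
    have h2 : D.1 y ≠ D.1 x := fun e' => hxy (by rw [← D.2.1 x, ← e', D.2.1])
    have h3 : D.1 y = x := by
      by_contra hne
      exact h2 (by rwa [Equiv.swap_apply_of_ne_of_ne hne (D.2.2 y)] at h1)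
    have h4 : D.1 x = y := by rw [← h3, D.2.1]
    rw [h4, hl]
  · intro D hD
    simp only [BD, Finset.mem_filter, Finset.mem_univ, true_and] at hD ⊢
    exact hD.exchange hx hy
  · exact fun D _ => exchange_exchange D x y

end BrauerDiagram

theorem lemma3p3 {K : Type*} [Field K] [Infinite K] {m : ℕ}
    {V : Type*} [AddCommGroup V] [Module K V] (v : Module.Basis (Fin (2 * m)) K V)
    (n a b : ℕ) (ha : a ≤ n) (hb : b ≤ n) (hab : Even (a + b)) (h : 2 * m + 2 ≤ a + b)
    (X : BrauerDiagram n → BrauerAlgebra K n (-(2 * (m : K))))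
    (hX : ∀ D, BrauerAlgebra.Represents D (X D)) :
    MulOpposite.op (∑ D ∈ BrauerDiagram.BD n a b, X D) ∈ RingHom.ker (phi v n) := by
  choose σ hσ using BrauerDiagram.exists_isFrame (n := n)
  rw [RingHom.mem_ker]
  refine (tensorBasis v n).ext fun i => ?_
  rw [Finset.op_sum, map_sum, LinearMap.sum_apply, LinearMap.zero_apply]
  simp only [phi_apply_of_represents v (hX _) (hσ _) i]
  rw [Finset.sum_comm]
  refine Finset.sum_eq_zero fun j _ => ?_
  rw [← Finset.sum_smul, ← Finset.mul_sum,
    BrauerDiagram.sum_BD_pfaffianTerm ha hb (by omega) σ hσ, mul_zero, zero_smul]
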